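/- For a prime $p$, let $\mathbb{Z}_{(p)}$ be the ring of $p$-integral rational numbers, and interpret a congruence $\sum a(n)q^n\equiv\sum b(n)q^n\pmod{p^m}$ between series in $\mathbb{Z}_{(p)}[\![q]\!]$ coefficient-wise, i.e. $a(n)-b(n)\in p^m\mathbb{Z}_{(p)}$ for all $n\ge 0$. For even integers $k\ge 2$ let $B_k$ be the $k$-th Bernoulli number, $\sigma_{k-1}(n)=\sum_{d\mid n}d^{k-1}$, and define the Eisenstein series $$G_k:=-\frac{B_k}{2k}E_k:=-\frac{B_k}{2k}+\sum_{n=1}^{\infty}\sigma_{k-1}(n)q^n .$$ For integers $m\ge 1$, $\alpha\ge 0$ and $0\le r\le m-1$ define $$H(m,\alpha,r):=(-1)^{m+1+r}\binom{\alpha-1-r}{m-1-r}\binom{\alpha}{r},$$ where $\binom{x}{j}=\frac{x(x-1)\cdots(x-j+1)}{j!}$ for every integer $x$ and every integer $j\ge 0$. **Theorem.** Let $p\ge 5$ be prime, let $m\ge 1$, and let $k^*>m$ be an even integer with $(p-1)\nmid k^*$. Then for every integer $\alpha\ge 0$ the following two series have coefficients in $\mathbb{Z}_{(p)}$ and satisfy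 $$G_{\alpha(p-1)+k^*}\equiv\sum_{r=0}^{m-1}H(m,\alpha,r)\,G_{r(p-1)+k^*}\,E_{p-1}^{\alpha-r}\pmod{p^m}.$$ -/

import Mathlib

/-- The `q`-expansion `G_k = -B_k/(2k) + ∑_{n ≥ 1} σ_{k-1}(n) q^n` (for even `k ≥ 2`). -/
noncomputable def eisG (k : ℕ) : PowerSeries ℚ :=
  PowerSeries.mk fun n =>
    if n = 0 then -(bernoulli k / (2 * (k : ℚ)))
    else (ArithmeticFunction.sigma (k - 1) n : ℚ)

/-- The `q`-expansion `E_k = 1 - (2k/B_k) ∑_{n ≥ 1} σ_{k-1}(n) q^n`, so that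
`G_k = -(B_k/(2k)) E_k` for even `k ≥ 2`; for `k = 0` it is `E_0 = 1`. -/
noncomputable def eisE (k : ℕ) : PowerSeries ℚ :=
  PowerSeries.mk fun n =>
    if n = 0 then 1
    else -(2 * (k : ℚ) / bernoulli k) * (ArithmeticFunction.sigma (k - 1) n : ℚ)

/-- Integer powers of a power series over `ℚ` (meaningful for negative exponents when the constant
term is nonzero, as it is for `eisE`). -/
noncomputable def seriesZPow (f : PowerSeries ℚ) : ℤ → PowerSeries ℚ
  | Int.ofNat n => f ^ n
  | Int.negSucc n => f⁻¹ ^ (n + 1)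

/-- `H(m, α, r) = (-1)^(m+1+r) * C(α-1-r, m-1-r) * C(α, r)` for `0 ≤ r ≤ m-1`; the first binomial
coefficient is the generalized one, as its upper entry may be negative. -/
def coeffH (m α r : ℕ) : ℤ :=
  (-1) ^ (m + 1 + r) * Ring.choose ((α : ℤ) - 1 - (r : ℤ)) (m - 1 - r) * (α.choose r : ℤ)

/-- `x` lies in the ring `ℤ_(p)` of `p`-integral rational numbers. -/
def IsPIntegral (p : ℕ) (x : ℚ) : Prop := ¬ p ∣ x.den

/-- `f ≡ g (mod p^m)` coefficient-wise in `ℤ_(p)⟦q⟧`: all coefficients of `f` and `g` are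
`p`-integral, and the corresponding ones differ by an element of `p^m ℤ_(p)`. -/
def SeriesCongr (p m : ℕ) (f g : PowerSeries ℚ) : Prop :=
  ∀ n : ℕ, IsPIntegral p (PowerSeries.coeff n f) ∧ IsPIntegral p (PowerSeries.coeff n g) ∧
    ∃ c : ℚ, IsPIntegral p c ∧
      PowerSeries.coeff n f - PowerSeries.coeff n g = (p : ℚ) ^ m * c

/-! After division by `E_{p-1}^α`, and with `y = 1/E_{p-1}`, the claim says that the sequence
`G_{i(p-1)+k} y^i` agrees mod `p^m` at `i = α` with its Lagrange interpolant on `0, …, m-1`. For a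
geometric sequence `z^i` with `z ≡ 1` mod `p` this is the binomial series of `(1 + (z-1))^α` cut off
at order `m` (`dvd_interpError_pow`). The `n`-th coefficient of `G_K`, `n ≥ 1`, is a sum of powers
`s^(K-1)`, and `s^(i(p-1)+k-1) y^i = s^(k-1) (s^(p-1) y)^i`. If `p ∤ s` then `s^(p-1) y ≡ 1` mod
`p`; if `p ∣ s` then `p^m ∣ s^(k-1)`. The constant term reduces to the same case: `(1 - c^K) B_K /
K` is a `ℤ_(p)`-combination of powers `s^(K-1)` (`exists_bernoulli_moments`), and a suitable `c`
makes `1 - c^K` a unit that is constant mod `p^m` along the weights in question. -/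

/-- The Lagrange interpolation functional: `f α` minus the value at `α` of the polynomial of degree
less than `m` through the values of `f` at `0, …, m - 1`. -/
def interpError {R : Type*} [CommRing R] (m α : ℕ) (f : ℕ → R) : R :=
  f α - ∑ r ∈ Finset.range m, (coeffH m α r : R) * f r

/-! ### Lagrange interpolation of geometric sequences -/

theorem coeffH_succ (m α r : ℕ) (hr : r < m) :
    coeffH (m + 1) α r =
      coeffH m α r + (α.choose m : ℤ) * ((-1) ^ (m + r) * (m.choose r : ℤ)) := by
  have hpascal : Ring.choose ((α : ℤ) - 1 - r) (m - r) + Ring.choose ((α : ℤ) - 1 - r) (m - 1 - r)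
      = Ring.choose ((α : ℤ) - r) (m - r) := by
    have h := Ring.choose_succ_succ ((α : ℤ) - 1 - r) (m - 1 - r)
    rw [show (α : ℤ) - 1 - r + 1 = α - r by ring, show m - 1 - r + 1 = m - r by omega] at h
    exact add_comm _ _ |>.trans h.symm
  have hmul : Ring.choose ((α : ℤ) - r) (m - r) * (α.choose r : ℤ) =
      (α.choose m : ℤ) * (m.choose r : ℤ) := by
    rcases le_or_gt r α with h | h
    · rw [← Nat.cast_sub h, Ring.choose_natCast]
      have := Nat.choose_mul (n := α) (k := m) (s := r) hr.le
      rw [← Nat.cast_mul, ← Nat.cast_mul, this, mul_comm]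
    · rw [Nat.choose_eq_zero_of_lt h, Nat.choose_eq_zero_of_lt (h.trans hr)]
      simp
  unfold coeffH
  rw [show m + 1 - 1 - r = m - r by omega, mul_left_comm, ← hmul, ← hpascal]
  ring

theorem coeffH_self_succ (m α : ℕ) : coeffH (m + 1) α m = α.choose m := by
  unfold coeffH
  rw [show m + 1 - 1 - m = 0 by omega, Ring.choose_zero_right, show m + 1 + 1 + m = 2 * (m + 1) by ring,
    pow_mul]
  simp

theorem sum_coeffH_mul_pow_succ {R : Type*} [CommRing R] (m α : ℕ) (y : R) :
    ∑ r ∈ Finset.range (m + 1), (coeffH (m + 1) α r : R) * y ^ r =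
      ∑ r ∈ Finset.range m, (coeffH m α r : R) * y ^ r + (α.choose m : R) * (y - 1) ^ m := by
  have hbin : (y - 1) ^ m = ∑ r ∈ Finset.range m, (-1 : R) ^ (m + r) * (m.choose r : R) * y ^ r
      + y ^ m := by
    rw [sub_eq_add_neg, add_pow, Finset.sum_range_succ]
    congr 1
    · refine Finset.sum_congr rfl fun r hr => ?_
      have hr := Finset.mem_range.1 hr
      rw [show m + r = (m - r) + 2 * r by omega, pow_add, pow_mul]
      simp only [even_two, Even.neg_pow, one_pow, mul_one]
      ring
    · simp
  rw [Finset.sum_range_succ, hbin, coeffH_self_succ, mul_add, ← add_assoc, Finset.mul_sum,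
    ← Finset.sum_add_distrib]
  congr 1
  · refine Finset.sum_congr rfl fun r hr => ?_
    rw [coeffH_succ m α r (Finset.mem_range.1 hr)]
    push_cast
    ring
  · push_cast
    ring

/-- Lagrange form against Newton form: adding the node `m` adds `α.choose m` times the `m`-th
difference of `r ↦ y^r` at `0`, which is `(y-1)^m`. -/
theorem sum_coeffH_mul_pow {R : Type*} [CommRing R] (m α : ℕ) (y : R) :
    ∑ r ∈ Finset.range m, (coeffH m α r : R) * y ^ r =
      ∑ j ∈ Finset.range m, (α.choose j : R) * (y - 1) ^ j := by
  induction m with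
  | zero => simp
  | succ m ih => rw [sum_coeffH_mul_pow_succ, ih, Finset.sum_range_succ]

theorem dvd_interpError_pow {R : Type*} [CommRing R] (m α : ℕ) {q y : R} (h : q ∣ y - 1) :
    q ^ m ∣ interpError m α (fun i => y ^ i) := by
  -- The `max` covers `α < m` too: the extra binomials vanish, and only terms with `j ≥ m` remain.
  have hα : y ^ α = ∑ j ∈ Finset.range (max m (α + 1)), (α.choose j : R) * (y - 1) ^ j := by
    have : y ^ α = ∑ j ∈ Finset.range (α + 1), (α.choose j : R) * (y - 1) ^ j := by
      conv_lhs => rw [← sub_add_cancel y 1, add_pow]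
      refine Finset.sum_congr rfl fun j _ => ?_
      simp [mul_comm]
    rw [this]
    refine Finset.sum_subset (Finset.range_mono (le_max_right _ _)) fun j _ hj => ?_
    rw [Nat.choose_eq_zero_of_lt (by rw [Finset.mem_range] at hj; omega)]
    simp
  simp only [interpError]
  rw [sum_coeffH_mul_pow, hα,
    ← Finset.sum_sdiff (Finset.range_subset_range.2 (le_max_left m (α + 1))), add_sub_cancel_right]
  refine Finset.dvd_sum fun j hj => Dvd.dvd.mul_left ?_ _
  have hj : m ≤ j := by
    simp only [Finset.mem_sdiff, Finset.mem_range, not_lt] at hj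
    exact hj.2
  exact (pow_dvd_pow q hj).trans (pow_dvd_pow_of_dvd h j)

/-! ### Bernoulli numbers as moments -/

open PowerSeries in
/-- For `c` invertible in `A`, the numbers `(1 - c ^ K) B_K / K` are moments of a finitely
supported `A`-valued measure on `ℕ`. -/
theorem exists_bernoulli_moments (A : Subring ℚ) (c : ℕ) (d : A) (hd : (c : A) * d = 1) (N : ℕ) :
    ∃ W : Polynomial A, ∀ K, 1 ≤ K → K ≤ N + 1 →
      (1 - (c : ℚ) ^ K) * bernoulli K / K =
        ∑ s ∈ W.support, (W.coeff s : ℚ) * (s : ℚ) ^ (K - 1) := by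
  obtain ⟨v, hv⟩ : ∃ v : Polynomial A,
      (Polynomial.X : Polynomial A) ^ c - 1 =
        (Polynomial.X - 1) * ((c : Polynomial A) + (Polynomial.X - 1) * v) := by
    have h1 : (Polynomial.X - 1 : Polynomial A) ∣
        (∑ i ∈ Finset.range c, (Polynomial.X : Polynomial A) ^ i) -
          (c : Polynomial A) := by
      rw [← Polynomial.C_1, Polynomial.dvd_iff_isRoot]
      simp [Polynomial.eval_finsetSum]
    obtain ⟨v, hv⟩ := h1
    refine ⟨v, ?_⟩
    rw [← hv, ← mul_geom_sum]
    ring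
  set T : Polynomial A := Polynomial.X - 1 with hT
  set z : Polynomial A := -(Polynomial.C d * T * v) with hz
  have hC : (c : Polynomial A) * Polynomial.C d = 1 := by
    rw [← Polynomial.C_eq_natCast, ← Polynomial.C_mul, hd, Polynomial.C_1]
  -- With `X = e^t`, `v/(c + Tv) = 1/(e^t-1) - c/(e^{ct}-1)` generates `(1 - c^K) B_K / K!`. `W`
  -- truncates its `T`-adic expansion; since `t ∣ e^t - 1`, the error is `O(t^(N+1))`.
  let W : Polynomial A := Polynomial.C d * v * ∑ i ∈ Finset.range (N + 1), z ^ i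
  have hW : (c + T * v) * W = v - T ^ (N + 1) * (v * (-(Polynomial.C d * v)) ^ (N + 1)) := by
    have h1 := mul_neg_geom_sum z (N + 1)
    have h2 : (c + T * v) * Polynomial.C d = 1 - z := by
      rw [hz, add_mul, hC]; ring
    have h3 : z ^ (N + 1) = T ^ (N + 1) * (-(Polynomial.C d * v)) ^ (N + 1) := by
      rw [← mul_pow, hz]; ring
    calc (c + T * v) * W = ((c + T * v) * Polynomial.C d) * (∑ i ∈ Finset.range (N + 1), z ^ i) * v :=
          by simp only [W]; ring
      _ = v - T ^ (N + 1) * (v * (-(Polynomial.C d * v)) ^ (N + 1)) := by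
          rw [h2, h1, h3]; ring
  refine ⟨W, fun K hK1 hKN => ?_⟩
  let φ : Polynomial A →+* ℚ⟦X⟧ :=
    Polynomial.eval₂RingHom ((C : ℚ →+* ℚ⟦X⟧).comp A.subtype) (exp ℚ)
  have hφX : φ Polynomial.X = exp ℚ := by simp [φ]
  have hφW : φ W = ∑ s ∈ W.support, C (W.coeff s : ℚ) * exp ℚ ^ s := by
    simp [φ, Polynomial.eval₂_eq_sum, Polynomial.sum_def]
  let τ : ℚ⟦X⟧ := exp ℚ - 1
  have hφT : φ T = τ := by simp [hT, hφX, τ]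
  let B : ℚ⟦X⟧ := bernoulliPowerSeries ℚ
  have hB : B * τ = X := bernoulliPowerSeries_mul_exp_sub_one ℚ
  have hBc : rescale (c : ℚ) B * (exp ℚ ^ c - 1) = C (c : ℚ) * X := by
    have := congrArg (rescale (c : ℚ)) hB
    rwa [map_mul, map_sub, map_one, ← exp_pow_eq_rescale_exp, rescale_X] at this
  have hX : (X : ℚ⟦X⟧) ∣ τ := by
    rw [X_dvd_iff]; simp [τ]
  obtain ⟨ε, hε⟩ := hX
  have hv' : exp ℚ ^ c - 1 = τ * (C (c : ℚ) + τ * φ v) := by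
    have := congrArg φ hv
    rw [map_mul, map_add, map_mul φ T, hφT, map_sub, map_pow, hφX] at this
    simpa using this
  have hW' : (C (c : ℚ) + τ * φ v) * φ W = φ v - τ ^ (N + 1) * φ (v * (-(Polynomial.C d * v)) ^ (N + 1)) := by
    have := congrArg φ hW
    rw [map_mul, map_sub, map_mul φ (T ^ (N + 1)), map_pow, map_add, map_mul φ T, hφT] at this
    simpa using this
  set ρ := φ (v * (-(Polynomial.C d * v)) ^ (N + 1))
  -- The truncated identity for `W(e^t)`, multiplied by `c t^2` to clear denominators.
  have key : C (c : ℚ) * (X * (X * φ W)) =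
      C (c : ℚ) * (X * (B - rescale (c : ℚ) B)) -
        X ^ (N + 3) * (ε ^ (N + 2) * ρ * rescale (c : ℚ) B) := by
    have h1 : τ * (exp ℚ ^ c - 1) * φ W = (exp ℚ ^ c - 1) - C (c : ℚ) * τ - τ ^ (N + 3) * ρ := by
      linear_combination (τ * φ W - 1) * hv' + τ ^ 2 * hW'
    have h2 : τ ^ (N + 3) * B = X ^ (N + 3) * ε ^ (N + 2) := by
      rw [pow_succ τ, mul_assoc, mul_comm τ B, hB, hε, mul_pow]; ring
    linear_combination B * rescale (c : ℚ) B * h1 - (rescale (c : ℚ) B * (exp ℚ ^ c - 1) * φ W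
      + C (c : ℚ) * rescale (c : ℚ) B) * hB
      + (B - X * φ W) * hBc - ρ * rescale (c : ℚ) B * h2
  obtain ⟨K, rfl⟩ : ∃ K', K = K' + 1 := ⟨K - 1, by omega⟩
  have hc : (c : ℚ) ≠ 0 := by
    rintro h
    have := congrArg (Subtype.val) hd
    simp [h] at this
  have hcoeff := congrArg (coeff (K + 2)) key
  have hz : coeff (K + 2) (X ^ (N + 3) * (ε ^ (N + 2) * ρ * rescale (c : ℚ) B)) = 0 := by
    rw [coeff_X_pow_mul', if_neg (by omega)]
  rw [map_sub, hz, sub_zero, coeff_C_mul, coeff_C_mul, mul_right_inj' hc, coeff_succ_X_mul,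
    coeff_succ_X_mul, coeff_succ_X_mul, hφW, map_sum, map_sub, coeff_rescale] at hcoeff
  simp only [coeff_C_mul, exp_pow_eq_rescale_exp, coeff_rescale, coeff_exp, B,
    bernoulliPowerSeries, coeff_mk, Algebra.algebraMap_self, RingHom.id_apply] at hcoeff
  have hf : (Nat.factorial K : ℚ) ≠ 0 := mod_cast Nat.factorial_ne_zero K
  have hsum : ∑ s ∈ W.support, (W.coeff s : ℚ) * (s : ℚ) ^ K =
      (∑ s ∈ W.support, (W.coeff s : ℚ) * ((s : ℚ) ^ K * (1 / (Nat.factorial K : ℚ)))) *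
        Nat.factorial K := by
    rw [Finset.sum_mul]
    refine Finset.sum_congr rfl fun s _ => ?_
    field_simp
  rw [Nat.add_sub_cancel, hsum, hcoeff, Nat.factorial_succ]
  push_cast
  have : (K : ℚ) + 1 ≠ 0 := by positivity
  field_simp

/-! ### Linearity and divisibility of the interpolation error -/

section interpError

variable {R S : Type*} [CommRing R] [CommRing S] (m α : ℕ)

theorem interpError_sum {ι : Type*} (t : Finset ι) (f : ι → ℕ → R) :
    interpError m α (fun i => ∑ j ∈ t, f j i) = ∑ j ∈ t, interpError m α (f j) := by
  simp only [interpError, Finset.sum_sub_distrib, Finset.mul_sum]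
  rw [Finset.sum_comm]

theorem interpError_map (φ : R →+ S) (f : ℕ → R) :
    interpError m α (fun i => φ (f i)) = φ (interpError m α f) := by
  simp only [interpError, map_sub, map_sum, ← zsmul_eq_mul, map_zsmul]

theorem interpError_mul_left (a : R) (f : ℕ → R) :
    interpError m α (fun i => a * f i) = a * interpError m α f :=
  interpError_map m α (AddMonoidHom.mulLeft a) f

variable {m α}

/-- Only the indices `α` and `r < m` enter. A finite bound is essential later, as a moment
polynomial serves only boundedly many weights. -/
theorem dvd_interpError_of_forall_dvd {q : R} {f : ℕ → R}
    (h : ∀ i ≤ α + m, q ∣ f i) : q ∣ interpError m α f :=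
  dvd_sub (h α (by omega)) <| Finset.dvd_sum fun r hr =>
    (h r (by have := Finset.mem_range.1 hr; omega)).mul_left _

theorem dvd_interpError_congr {q : R} {f g : ℕ → R}
    (h : ∀ i ≤ α + m, q ∣ f i - g i) (hg : q ∣ interpError m α g) : q ∣ interpError m α f := by
  have hfg : interpError m α f = interpError m α (fun i => f i - g i) + interpError m α g := by
    simp only [interpError, mul_sub, Finset.sum_sub_distrib]
    ring
  rw [hfg]
  exact dvd_add (dvd_interpError_of_forall_dvd h) hg

theorem dvd_natCast_pow_sub_one {p : ℕ} (hp : p.Prime) {s : ℕ} (hs : ¬ p ∣ s) :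
    (p : R) ∣ (s : R) ^ (p - 1) - 1 := by
  have h : (p : ℤ) ∣ (s : ℤ) ^ (p - 1) - 1 :=
    (Int.ModEq.pow_card_sub_one_eq_one hp
      (Nat.isCoprime_iff_coprime.2 ((hp.coprime_iff_not_dvd.2 hs).symm))).symm.dvd
  simpa using map_dvd (Int.castRingHom R) h

theorem dvd_interpError_natCast_pow_mul {p : ℕ} (hp : p.Prime) {k : ℕ} (hk : m < k) (s : ℕ)
    {y : R} (hy : (p : R) ∣ y - 1) :
    (p : R) ^ m ∣ interpError m α (fun i => (s : R) ^ (i * (p - 1) + k - 1) * y ^ i) := by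
  have hexp : ∀ i, i * (p - 1) + k - 1 = (k - 1) + (p - 1) * i := fun i => by
    rw [mul_comm]; omega
  have hfun : (fun i => (s : R) ^ (i * (p - 1) + k - 1) * y ^ i) =
      fun i => (s : R) ^ (k - 1) * ((s : R) ^ (p - 1) * y) ^ i := by
    funext i
    rw [hexp, pow_add, pow_mul, mul_pow, mul_assoc]
  rw [hfun, interpError_mul_left]
  by_cases hs : p ∣ s
  · refine Dvd.dvd.mul_right ((pow_dvd_pow _ (by omega : m ≤ k - 1)).trans ?_) _
    exact pow_dvd_pow_of_dvd (Nat.cast_dvd_cast hs) _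
  · refine Dvd.dvd.mul_left (dvd_interpError_pow m α ?_) _
    have h := dvd_add ((dvd_natCast_pow_sub_one (R := R) hp hs).mul_right y) hy
    rwa [show ((s : R) ^ (p - 1) - 1) * y + (y - 1) = (s : R) ^ (p - 1) * y - 1 by ring] at h

end interpError

/-! ### The ring `ℤ_(p)` and `E_{p-1}` mod `p` -/

/-- The ring of `p`-integral rational numbers. -/
def pIntegralSubring (p : ℕ) (hp : p.Prime) : Subring ℚ where
  carrier := {x | IsPIntegral p x}
  mul_mem' {a b} ha hb h := ((hp.dvd_mul.1 (h.trans (Rat.mul_den_dvd a b))).elim ha hb)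
  one_mem' := by simpa [IsPIntegral] using hp.one_lt.ne'
  add_mem' {a b} ha hb h := ((hp.dvd_mul.1 (h.trans (Rat.add_den_dvd a b))).elim ha hb)
  zero_mem' := by simpa [IsPIntegral] using hp.one_lt.ne'
  neg_mem' {a} ha := by simpa [IsPIntegral] using ha

section pIntegralSubring

variable {p : ℕ} {hp : p.Prime}

theorem mem_pIntegralSubring {x : ℚ} : x ∈ pIntegralSubring p hp ↔ ¬ p ∣ x.den := Iff.rfl

theorem inv_natCast_mem_pIntegralSubring {n : ℕ} (hn : ¬ p ∣ n) :
    (n : ℚ)⁻¹ ∈ pIntegralSubring p hp := by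
  have h0 : n ≠ 0 := by rintro rfl; exact hn (dvd_zero p)
  rw [mem_pIntegralSubring, Rat.inv_natCast_den_of_pos (by omega)]
  exact hn

theorem isUnit_of_not_dvd {x : pIntegralSubring p hp} (h : ¬ (p : pIntegralSubring p hp) ∣ x) :
    IsUnit x := by
  have hden : ((x : ℚ).den : ℚ)⁻¹ ∈ pIntegralSubring p hp := inv_natCast_mem_pIntegralSubring x.2
  have hx : x = ((x : ℚ).num : pIntegralSubring p hp) * ⟨_, hden⟩ := by
    apply Subtype.ext
    push_cast
    rw [← div_eq_mul_inv, Rat.num_div_den]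
  have hnum : ¬ (p : ℤ) ∣ (x : ℚ).num := by
    intro hd
    apply h
    rw [hx]
    exact Dvd.dvd.mul_right (by simpa using map_dvd (Int.castRingHom (pIntegralSubring p hp)) hd) _
  have hinv : ((x : ℚ).num.natAbs : ℚ)⁻¹ ∈ pIntegralSubring p hp :=
    inv_natCast_mem_pIntegralSubring fun h => hnum (Int.natCast_dvd.2 h)
  have h0 : ((x : ℚ).num : ℚ) ≠ 0 := by
    rw [Int.cast_ne_zero]
    rintro h0
    exact hnum (h0 ▸ dvd_zero _)
  have hu : IsUnit ((x : ℚ).num : pIntegralSubring p hp) := by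
    have hu' : IsUnit ((x : ℚ).num.natAbs : pIntegralSubring p hp) :=
      IsUnit.of_mul_eq_one ⟨_, hinv⟩ (Subtype.ext (by
        push_cast
        exact mul_inv_cancel₀ (by simpa using h0)))
    rcases Int.natAbs_eq (x : ℚ).num with h1 | h1
    · rw [h1]; simpa using hu'
    · rw [h1]; simpa using hu'
  rw [hx]
  refine hu.mul (IsUnit.of_mul_eq_one ((x : ℚ).den : pIntegralSubring p hp) (Subtype.ext ?_))
  push_cast
  exact inv_mul_cancel₀ (by simp)

theorem not_dvd_one_pIntegralSubring : ¬ (p : pIntegralSubring p hp) ∣ 1 := by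
  rintro ⟨x, hx⟩
  have hx' : (1 : ℚ) = p * x := by simpa using congrArg Subtype.val hx
  have hmem := x.2
  have hp0 : (p : ℚ) ≠ 0 := mod_cast hp.ne_zero
  rw [show (x : ℚ) = (p : ℚ)⁻¹ by field_simp; linarith, mem_pIntegralSubring,
    Rat.inv_natCast_den_of_pos hp.pos] at hmem
  exact hmem dvd_rfl

theorem not_dvd_natCast {n : ℕ} (hn : ¬ p ∣ n) : ¬ (p : pIntegralSubring p hp) ∣ n := by
  intro h
  refine not_dvd_one_pIntegralSubring (hp := hp) (h.trans ⟨⟨_, inv_natCast_mem_pIntegralSubring hn⟩, ?_⟩)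
  apply Subtype.ext
  push_cast
  refine (mul_inv_cancel₀ ?_).symm
  rw [Nat.cast_ne_zero]
  rintro rfl
  exact hn (dvd_zero p)

theorem isUnit_natCast {n : ℕ} (hn : ¬ p ∣ n) : IsUnit (n : pIntegralSubring p hp) :=
  isUnit_of_not_dvd (not_dvd_natCast hn)

/-- A consequence of the von Staudt–Clausen theorem: `p B_{p-1}` is congruent to `-1` modulo `p`. -/
theorem exists_mul_bernoulli_eq (hp2 : p ≠ 2) :
    ∃ a : pIntegralSubring p hp, (p : ℚ) * bernoulli (p - 1) = p * a - 1 := by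
  obtain ⟨l, hl⟩ := hp.even_sub_one hp2
  have hl : p - 1 = 2 * l := by omega
  obtain ⟨z, hz⟩ := Bernoulli.vonStaudt_clausen l
  rw [← hl, show p - 1 + 2 = p + 1 by have := hp.two_le; omega, Finset.range_add_one,
    Finset.filter_insert, if_pos ⟨hp, dvd_rfl⟩, Finset.sum_insert (by simp)] at hz
  have hmem : ∑ q ∈ Finset.range p with q.Prime ∧ (q - 1) ∣ p - 1, (1 : ℚ) / q ∈
      pIntegralSubring p hp := by
    refine Subring.sum_mem _ fun q hq => ?_
    rw [Finset.mem_filter, Finset.mem_range] at hq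
    rw [one_div]
    exact inv_natCast_mem_pIntegralSubring (Nat.not_dvd_of_pos_of_lt hq.2.1.pos hq.1)
  refine ⟨z - ⟨_, hmem⟩, ?_⟩
  have hp0 : (p : ℚ) ≠ 0 := mod_cast hp.ne_zero
  push_cast
  rw [hz]
  field_simp
  ring

open PowerSeries in
/-- `E_{p-1}` is congruent to `1` modulo `p`. -/
theorem exists_map_eq_eisE (hp2 : p ≠ 2) :
    ∃ U : (pIntegralSubring p hp)⟦X⟧ˣ, map (pIntegralSubring p hp).subtype U = eisE (p - 1) ∧
      (p : (pIntegralSubring p hp)⟦X⟧) ∣ U - 1 := by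
  obtain ⟨a, ha⟩ := exists_mul_bernoulli_eq (hp := hp) hp2
  have hu : IsUnit ((p : pIntegralSubring p hp) * a - 1) := by
    apply isUnit_of_not_dvd
    intro h
    apply not_dvd_one_pIntegralSubring (hp := hp)
    have := dvd_sub (dvd_mul_right (p : pIntegralSubring p hp) a) h
    simpa using this
  obtain ⟨b, hb⟩ := hu.exists_right_inv
  have hb' : (p : ℚ) * bernoulli (p - 1) * b = 1 := by
    rw [ha]
    simpa using congrArg Subtype.val hb
  have hp0 : (p : ℚ) ≠ 0 := mod_cast hp.ne_zero
  have hB0 : bernoulli (p - 1) ≠ 0 := by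
    rintro h
    simp [h] at hb'
  -- Here `b = 1/(p B_{p-1})`, so `2(p-1)/B_{p-1} = p · 2(p-1)b` and `E_{p-1} = 1 + pZ`.
  let Z : (pIntegralSubring p hp)⟦X⟧ := PowerSeries.mk fun n => if n = 0 then 0 else
    -(2 * ((p - 1 : ℕ) : pIntegralSubring p hp) * b) *
      (ArithmeticFunction.sigma (p - 1 - 1) n : pIntegralSubring p hp)
  have hunit : IsUnit (1 + (p : (pIntegralSubring p hp)⟦X⟧) * Z) := by
    rw [isUnit_iff_constantCoeff]
    have : constantCoeff Z = 0 := by simp [Z, ← coeff_zero_eq_constantCoeff_apply]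
    simp [this]
  refine ⟨hunit.unit, ?_, by simp⟩
  ext n
  rw [IsUnit.unit_spec, map_add, map_mul, map_one, map_natCast, eisE, coeff_mk, map_add,
    ← map_natCast (C : ℚ →+* ℚ⟦X⟧), coeff_C_mul, coeff_map, coeff_mk]
  by_cases hn : n = 0
  · simp [hn]
  · have hb2 : (b : ℚ) = (p : ℚ)⁻¹ * (bernoulli (p - 1))⁻¹ := by
      field_simp
      linarith
    have h2 : ((2 : pIntegralSubring p hp) : ℚ) = 2 := rfl
    simp [hn, coeff_one, hb2, h2]
    field_simp

end pIntegralSubring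

/-! ### Approximate roots of unity -/

theorem exists_approx_rootOfUnity {p : ℕ} (hp : p.Prime) (m : ℕ) {k : ℕ} (hpk : ¬ (p - 1) ∣ k) :
    ∃ c : ℕ, ¬ p ∣ c ∧ (p : ℤ) ^ m ∣ (c : ℤ) ^ (p - 1) - 1 ∧ ¬ (p : ℤ) ∣ 1 - (c : ℤ) ^ k := by
  have := Fact.mk hp
  obtain ⟨g, hg⟩ := IsCyclic.exists_generator (α := (ZMod p)ˣ)
  have hord : orderOf g = p - 1 := by
    rw [orderOf_eq_card_of_forall_mem_zpowers hg, Nat.card_eq_fintype_card, ZMod.card_units]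
  let n : ℕ := (g : ZMod p).val
  have hn : (n : ZMod p) = g := by simp [n]
  have hpn : ¬ p ∣ n := by
    rw [← CharP.cast_eq_zero_iff (ZMod p), hn]
    exact g.ne_zero
  -- An approximate Teichmüller lift: `n^(p^m)` is still the primitive root `g` mod `p`, while its
  -- `(p-1)`-th power is `1` mod `p^(m+1)`.
  refine ⟨n ^ p ^ m, fun h => hpn (hp.dvd_of_dvd_pow h), ?_, ?_⟩
  · have h1 : (p : ℤ) ∣ (n : ℤ) ^ (p - 1) - 1 := by
      simpa using dvd_natCast_pow_sub_one (R := ℤ) hp hpn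
    have h2 := dvd_sub_pow_of_dvd_sub h1 m
    push_cast
    rw [← pow_mul, mul_comm, pow_mul]
    rw [one_pow] at h2
    exact (pow_dvd_pow _ (Nat.le_succ m)).trans h2
  · rw [← ZMod.intCast_zmod_eq_zero_iff_dvd]
    push_cast
    rw [hn, ZMod.pow_card_pow, sub_eq_zero]
    intro h
    apply hpk
    rw [← hord]
    apply orderOf_dvd_of_pow_eq_one
    apply Units.ext
    simpa using h.symm

/-! ### Coefficients of Eisenstein series -/

section Eisenstein

variable {p : ℕ} {hp : p.Prime} {m k : ℕ}

theorem dvd_pow_sub_pow_of_dvd_pow_sub_one {R : Type*} [CommRing R] {q c : R} {n : ℕ}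
    (h : q ∣ c ^ n - 1) (i k : ℕ) : q ∣ c ^ (i * n + k) - c ^ k := by
  have h1 : q ∣ (c ^ n) ^ i - 1 := h.trans (sub_one_dvd_pow_sub_one _ i)
  rw [pow_add, mul_comm i, pow_mul, ← sub_one_mul]
  exact h1.mul_right _

theorem isUnit_one_sub_pow {c : pIntegralSubring p hp} (hm : m ≠ 0)
    (hc : (p : pIntegralSubring p hp) ^ m ∣ c ^ (p - 1) - 1) (hck : IsUnit (1 - c ^ k)) (i : ℕ) :
    IsUnit (1 - c ^ (i * (p - 1) + k)) := by
  apply isUnit_of_not_dvd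
  intro h
  have h1 := dvd_pow_sub_pow_of_dvd_pow_sub_one ((dvd_pow_self _ hm).trans hc) i k
  have h2 := dvd_add h h1
  rw [sub_add_sub_cancel] at h2
  exact not_dvd_one_pIntegralSubring (h2.trans hck.dvd)

theorem exists_unit_approx_rootOfUnity (hp : p.Prime) (m : ℕ) (hpk : ¬ (p - 1) ∣ k) :
    ∃ c : ℕ, IsUnit (c : pIntegralSubring p hp) ∧
      (p : pIntegralSubring p hp) ^ m ∣ (c : pIntegralSubring p hp) ^ (p - 1) - 1 ∧
      IsUnit (1 - (c : pIntegralSubring p hp) ^ k) := by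
  obtain ⟨c, h1, h2, h3⟩ := exists_approx_rootOfUnity hp m hpk
  refine ⟨c, isUnit_natCast h1, ?_, ?_⟩
  · simpa using map_dvd (Int.castRingHom (pIntegralSubring p hp)) h2
  · have h4 : IsUnit ((1 - (c : ℤ) ^ k).natAbs : pIntegralSubring p hp) :=
      isUnit_natCast fun h => h3 (Int.natCast_dvd.2 h)
    have h5 : (1 - (c : pIntegralSubring p hp) ^ k) = ((1 - (c : ℤ) ^ k : ℤ) : pIntegralSubring p hp) := by
      push_cast; rfl
    rw [h5]
    rcases Int.natAbs_eq (1 - (c : ℤ) ^ k) with h | h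
    · rw [h]; simpa using h4
    · rw [h]; simpa using h4

theorem coeff_eisG_eq_sum (n : ℕ) (hn : n ≠ 0) (K : ℕ) :
    PowerSeries.coeff n (eisG K) = ∑ s ∈ n.divisors, (s : ℚ) ^ (K - 1) := by
  simp [eisG, hn, ArithmeticFunction.sigma_apply]

/-- Up to a factor that is a unit in `ℤ_(p)`, the constant terms of the `G_K` are moments. -/
theorem exists_moments_coeff_zero_eisG (hp : p.Prime) {c : ℕ} (hc : IsUnit (c : pIntegralSubring p hp))
    (N : ℕ) :
    ∃ W : Polynomial (pIntegralSubring p hp), ∀ K, 1 ≤ K → K ≤ N + 1 →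
      -2 * (1 - (c : ℚ) ^ K) * PowerSeries.coeff 0 (eisG K) =
        ∑ s ∈ W.support, (W.coeff s : ℚ) * (s : ℚ) ^ (K - 1) := by
  obtain ⟨d, hd⟩ := hc.exists_right_inv
  obtain ⟨W, hW⟩ := exists_bernoulli_moments _ c d hd N
  refine ⟨W, fun K h1 h2 => ?_⟩
  rw [← hW K h1 h2]
  have : (K : ℚ) ≠ 0 := by positivity
  simp only [eisG, PowerSeries.coeff_mk, if_true]
  field_simp

theorem coe_two_pIntegralSubring : ((2 : pIntegralSubring p hp) : ℚ) = 2 := rfl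

theorem pos_of_not_dvd {q : ℕ} (h : ¬ q ∣ k) (i : ℕ) : 1 ≤ i * q + k := by
  have : k ≠ 0 := by rintro rfl; exact h (dvd_zero _)
  omega

theorem isUnit_neg_two (hp2 : p ≠ 2) : IsUnit (-2 : pIntegralSubring p hp) := by
  have : IsUnit ((2 : ℕ) : pIntegralSubring p hp) :=
    isUnit_natCast fun h => hp2 ((Nat.prime_dvd_prime_iff_eq hp Nat.prime_two).1 h)
  simpa using this.neg

theorem coeff_eisG_mem (hp2 : p ≠ 2) (hpk : ¬ (p - 1) ∣ k) (i n : ℕ) :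
    PowerSeries.coeff n (eisG (i * (p - 1) + k)) ∈ pIntegralSubring p hp := by
  by_cases hn : n = 0
  · subst hn
    -- Precision `1` suffices for integrality: `1 - c^K` need only remain a unit.
    obtain ⟨c, h1, h2, h3⟩ := exists_unit_approx_rootOfUnity hp 1 hpk
    obtain ⟨W, hW⟩ := exists_moments_coeff_zero_eisG hp h1 (i * (p - 1) + k)
    have h4 := (isUnit_neg_two (hp := hp) hp2).mul (isUnit_one_sub_pow one_ne_zero h2 h3 i)
    obtain ⟨b, hb⟩ := h4.exists_left_inv
    have hb' : (b : ℚ) * (-2 * (1 - (c : ℚ) ^ (i * (p - 1) + k))) = 1 :=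
      by simpa [coe_two_pIntegralSubring] using congrArg Subtype.val hb
    rw [← one_mul (PowerSeries.coeff 0 _), ← hb', mul_assoc,
      hW _ (pos_of_not_dvd hpk i) (Nat.le_succ _)]
    exact mul_mem b.2 (sum_mem fun s _ => mul_mem (W.coeff s).2 (pow_mem (natCast_mem _ s) _))
  · rw [coeff_eisG_eq_sum n hn]
    exact sum_mem fun s _ => pow_mem (natCast_mem _ s) _

theorem dvd_interpError_C_mul_pow {α : ℕ} (hmk : m < k) (hp2 : p ≠ 2)
    (hpk : ¬ (p - 1) ∣ k) (n : ℕ) {G : ℕ → pIntegralSubring p hp}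
    (hG : ∀ i, (G i : ℚ) = PowerSeries.coeff n (eisG (i * (p - 1) + k)))
    {y : PowerSeries (pIntegralSubring p hp)} (hy : (p : PowerSeries (pIntegralSubring p hp)) ∣ y - 1) :
    (p : PowerSeries (pIntegralSubring p hp)) ^ m ∣
      interpError m α (fun i => PowerSeries.C (G i) * y ^ i) := by
  by_cases hn : n = 0
  · subst hn
    obtain ⟨c, h1, h2, h3⟩ := exists_unit_approx_rootOfUnity hp m hpk
    obtain ⟨W, hW⟩ := exists_moments_coeff_zero_eisG hp h1 ((α + m) * (p - 1) + k)
    have hu := ((isUnit_neg_two (hp := hp) hp2).mul h3).map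
      (PowerSeries.C : pIntegralSubring p hp →+* PowerSeries (pIntegralSubring p hp))
    -- Multiplying by the fixed unit `-2(1 - c^k)` is harmless; mod `p^m` it may then be replaced by
    -- `-2(1 - c^K)`, with `K` varying with `i`, which yields moments.
    rw [← hu.dvd_mul_left, ← interpError_mul_left]
    have hsum : (p : PowerSeries (pIntegralSubring p hp)) ^ m ∣ interpError m α (fun i =>
        ∑ s ∈ W.support, PowerSeries.C (W.coeff s) *
          ((s : PowerSeries (pIntegralSubring p hp)) ^ (i * (p - 1) + k - 1) * y ^ i)) := by
      rw [interpError_sum]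
      refine Finset.dvd_sum fun s _ => ?_
      rw [interpError_mul_left]
      exact (dvd_interpError_natCast_pow_mul hp hmk s hy).mul_left _
    refine dvd_interpError_congr (fun i hi => ?_) hsum
    have hmom : -2 * (1 - (c : pIntegralSubring p hp) ^ (i * (p - 1) + k)) * G i =
        ∑ s ∈ W.support, W.coeff s * (s : pIntegralSubring p hp) ^ (i * (p - 1) + k - 1) := by
      apply Subtype.ext
      have := hW (i * (p - 1) + k) (pos_of_not_dvd hpk i)
        (Nat.le_succ_of_le (by gcongr))
      rw [← hG] at this
      simpa [coe_two_pIntegralSubring] using this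
    have hfactor : (∑ s ∈ W.support, PowerSeries.C (W.coeff s) *
          ((s : PowerSeries (pIntegralSubring p hp)) ^ (i * (p - 1) + k - 1) * y ^ i)) =
        PowerSeries.C (-2 * (1 - (c : pIntegralSubring p hp) ^ (i * (p - 1) + k)) * G i) * y ^ i := by
      rw [hmom, map_sum, Finset.sum_mul]
      refine Finset.sum_congr rfl fun s _ => ?_
      rw [map_mul, map_pow, map_natCast, mul_assoc]
    rw [hfactor, ← mul_assoc, ← map_mul, ← sub_mul, ← map_sub]
    refine Dvd.dvd.mul_right ?_ _
    rw [← map_natCast (PowerSeries.C : pIntegralSubring p hp →+* _), ← map_pow]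
    refine map_dvd _ ?_
    have h4 := (dvd_pow_sub_pow_of_dvd_pow_sub_one h2 i k).mul_left (-2 * G i)
    convert h4 using 1
    ring
  · have hsum : ∀ i, G i = ∑ s ∈ n.divisors, (s : pIntegralSubring p hp) ^ (i * (p - 1) + k - 1) :=
      fun i => Subtype.ext (by simpa [coeff_eisG_eq_sum n hn] using hG i)
    simp only [hsum, map_sum, map_pow, map_natCast, Finset.sum_mul]
    rw [interpError_sum]
    exact Finset.dvd_sum fun s _ => dvd_interpError_natCast_pow_mul hp hmk s hy

end Eisenstein

/-! ### Assembly -/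

theorem PowerSeries.C_dvd_of_forall_dvd_coeff {R : Type*} [CommRing R] {a : R} {f : PowerSeries R}
    (h : ∀ n, a ∣ PowerSeries.coeff n f) : PowerSeries.C a ∣ f := by
  choose g hg using h
  exact ⟨PowerSeries.mk g, by ext n; simp [hg]⟩

theorem map_units_zpow {R : Type*} [CommRing R] (φ : R →+* ℚ) (U : (PowerSeries R)ˣ) (z : ℤ) :
    PowerSeries.map φ ((U ^ z : (PowerSeries R)ˣ) : PowerSeries R) =
      seriesZPow (PowerSeries.map φ U) z := by
  have hinv : PowerSeries.map φ ((U⁻¹ : (PowerSeries R)ˣ) : PowerSeries R) =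
      (PowerSeries.map φ U)⁻¹ := by
    have h : PowerSeries.map φ ((U⁻¹ : (PowerSeries R)ˣ) : PowerSeries R) * PowerSeries.map φ U = 1 := by
      rw [← map_mul, Units.inv_mul, map_one]
    have h0 : PowerSeries.constantCoeff (PowerSeries.map φ U) ≠ 0 :=
      ((U.isUnit.map (PowerSeries.map φ)).map PowerSeries.constantCoeff).ne_zero
    exact (PowerSeries.eq_inv_iff_mul_eq_one h0).2 h
  cases z with
  | ofNat n => simp [seriesZPow]
  | negSucc n => rw [zpow_negSucc, ← inv_pow, Units.val_pow_eq_pow_val, map_pow, hinv]; rfl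

theorem theorem1p1 (p : ℕ) (hp : p.Prime) (hp5 : 5 ≤ p) (m : ℕ) (hm : 1 ≤ m)
    (k : ℕ) (hk_even : Even k) (hk : m < k) (hpk : ¬ (p - 1) ∣ k) (α : ℕ) :
    SeriesCongr p m (eisG (α * (p - 1) + k))
      (∑ r ∈ Finset.range m,
        PowerSeries.C (coeffH m α r : ℚ) * eisG (r * (p - 1) + k) *
          seriesZPow (eisE (p - 1)) ((α : ℤ) - (r : ℤ))) := by
  have hp2 : p ≠ 2 := by omega
  let A := pIntegralSubring p hp
  obtain ⟨U, hUE, hU1⟩ := exists_map_eq_eisE (hp := hp) hp2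
  have hUE : PowerSeries.map A.subtype U = eisE (p - 1) := hUE
  let y : PowerSeries A := (U⁻¹ : (PowerSeries A)ˣ)
  have hy : (p : PowerSeries A) ∣ y - 1 := by
    have := (hU1.mul_left y).neg_right
    rwa [mul_sub, Units.inv_mul, mul_one, neg_sub] at this
  let G : ℕ → PowerSeries A := fun i => PowerSeries.mk fun n => ⟨_, coeff_eisG_mem hp2 hpk i n⟩
  have hG : ∀ i, PowerSeries.map A.subtype (G i) = eisG (i * (p - 1) + k) := fun i => by
    ext n; simp [G]
  have herr : (p : PowerSeries A) ^ m ∣ interpError m α (fun i => G i * y ^ i) := by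
    rw [← map_natCast (PowerSeries.C : A →+* PowerSeries A), ← map_pow]
    refine PowerSeries.C_dvd_of_forall_dvd_coeff fun n => ?_
    -- Expanding the product splits each `G i` into its coefficients while keeping `y^i` whole, so
    -- linearity reduces to one coefficient of `G` at a time.
    have hcoeff : PowerSeries.coeff n (interpError m α (fun i => G i * y ^ i)) =
        ∑ x ∈ Finset.HasAntidiagonal.antidiagonal n, PowerSeries.coeff x.2
          (interpError m α (fun i => PowerSeries.C (PowerSeries.coeff x.1 (G i)) * y ^ i)) := by
      have h1 : ∀ (l : ℕ) (f : ℕ → PowerSeries A), PowerSeries.coeff l (interpError m α f) =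
          interpError m α (fun i => PowerSeries.coeff l (f i)) := fun l f =>
        (interpError_map m α (PowerSeries.coeff (R := A) l).toAddMonoidHom f).symm
      simp only [h1, PowerSeries.coeff_C_mul]
      simp only [PowerSeries.coeff_mul, interpError_sum]
    rw [hcoeff]
    refine Finset.dvd_sum fun x _ => ?_
    obtain ⟨g, hg⟩ := dvd_interpError_C_mul_pow (α := α) hk hp2 hpk x.1
      (G := fun i => PowerSeries.coeff x.1 (G i)) (fun i => by simp [G]) hy
    rw [hg, ← map_natCast (PowerSeries.C : A →+* PowerSeries A), ← map_pow,
      PowerSeries.coeff_C_mul]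
    exact dvd_mul_right _ _
  -- Multiplying back by `E_{p-1}^α` turns `y^r` into `E_{p-1}^(α-r)`, also when `r > α`.
  obtain ⟨Q, hQ⟩ := herr.mul_right ((U ^ (α : ℤ) : (PowerSeries A)ˣ) : PowerSeries A)
  let S : PowerSeries A := ∑ r ∈ Finset.range m, (coeffH m α r : PowerSeries A) * G r *
    ((U ^ ((α : ℤ) - r) : (PowerSeries A)ˣ) : PowerSeries A)
  have hyU : ∀ r : ℕ, y ^ r * ((U ^ (α : ℤ) : (PowerSeries A)ˣ) : PowerSeries A) =
      ((U ^ ((α : ℤ) - r) : (PowerSeries A)ˣ) : PowerSeries A) := fun r => by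
    simp only [y]
    rw [← Units.val_pow_eq_pow_val, ← Units.val_mul, zpow_sub, inv_pow, zpow_natCast U r, mul_comm]
  have hdiff : G α - S = (p : PowerSeries A) ^ m * Q := by
    rw [← hQ, interpError, sub_mul, mul_assoc, hyU, sub_self, zpow_zero, Units.val_one, mul_one,
      Finset.sum_mul]
    simp only [mul_assoc, hyU, S]
  have hS : PowerSeries.map A.subtype S = ∑ r ∈ Finset.range m,
        PowerSeries.C (coeffH m α r : ℚ) * eisG (r * (p - 1) + k) *
          seriesZPow (eisE (p - 1)) ((α : ℤ) - (r : ℤ)) := by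
    simp only [S, map_sum, map_mul, map_intCast, hG, map_units_zpow, hUE]
  rw [← hS, ← hG]
  intro n
  refine ⟨?_, ?_, (PowerSeries.coeff n Q : A), (PowerSeries.coeff n Q).2, ?_⟩
  · rw [PowerSeries.coeff_map]; exact (PowerSeries.coeff n (G α)).2
  · rw [PowerSeries.coeff_map]; exact (PowerSeries.coeff n S).2
  · rw [← map_sub, ← map_sub, hdiff, ← map_natCast (PowerSeries.C : A →+* PowerSeries A),
      ← map_pow, PowerSeries.coeff_map, PowerSeries.coeff_C_mul]
    simp
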